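/- Fix the following notions, for integers $n\ge 1$ and $d,h,m\ge 0$. A self-attention head with value-embedding dimension $d$ is a function $A\colon\{0,1\}^n\to\mathbb{R}^d$ of the form $$A(x)=\frac{\sum_{i=1}^n \exp(\langle q(x_n),k_i(x_i)\rangle)\,v_i(x_i)}{\sum_{i=1}^n \exp(\langle q(x_n),k_i(x_i)\rangle)},$$ where $q,k_1,\dots,k_n\colon\{0,1\}\to\mathbb{H}$ are arbitrary functions into a real inner product space $\mathbb{H}$ and $v_1,\dots,v_n\colon\{0,1\}\to\mathbb{R}^d$ are arbitrary functions. A normalized ReLU network of width $m$ and depth $\ell$ is a scalar-output layered feed-forward network with at most $m$ ReLU gates in each of at most $\ell$ (and at least one) layers, where each gate computes $z\mapsto\max\{0,a^{\mathsf T}z+b\}$ with $\|a\|_1+|b|\le 1$; the output is an affine function $z\mapsto a^{\mathsf T}z+b$ with $\|a\|_1+|b|\le 1$ of the gate values of the last layer (in particular, it may be the value of a single gate). A function $T\colon\{0,1\}^n\to\mathbb{R}$ $(\tau,\gamma)$-represents $g\colon\{0,1\}^n\to\{0,1\}$ if, for every $x$, $g(x)=1$ implies $T(x)\ge\tau+\gamma$,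 and $g(x)=0$ implies $T(x)\le\tau-\gamma$. **Corollary.** There is a universal constant $K\in\mathbb{N}$ such that for every depth $\ell\in\mathbb{N}$ and every real $c$ there is $n_0=n_0(\ell,c)$ such that the following holds for all $n\ge n_0$, all $h,d,m$, all $\tau\in\mathbb{R}$ and all $\gamma\in(0,1]$ with $\gamma\ge n^{-c}$. Let $A_1,\dots,A_h\colon\{0,1\}^n\to\mathbb{R}^d$ be self-attention heads with $A_1(x)+\dots+A_h(x)\in[-1,1]^d$ for every $x\in\{0,1\}^n$, and let $u$ be a real-valued function that on $[-1,1]^d$ is computed by a normalized ReLU network of width $m$ and depth $\ell$. If $T(x)=u(A_1(x)+\dots+A_h(x))$ $(\tau,\gamma)$-represents the parity function on $n$ bits, then $$h\,m^{\ell}\;\ge\;\frac{n}{(\ln n)^{K\ell}}.$$ Thus, for constant depth $\ell$ and polynomial margin, $h\,m^\ell$ must be nearly linear in $n$, that is, at least $n$ divided by a fixed power of $\ln n$. -/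

import Mathlib

universe u

/-- The data of a self-attention head on `n` input bits with value-embedding dimension `d`:
a real inner product space `H`, a query embedding, and position-specific key and value
embeddings, all of them arbitrary functions of a bit. -/
structure SelfAttentionHead (n d : ℕ) where
  /-- the inner product space of the query and key embeddings -/
  H : Type u
  [instNormed : NormedAddCommGroup H]
  [instInner : InnerProductSpace ℝ H]
  /-- the query embedding -/
  query : Bool → H
  /-- the key embeddings -/
  key : Fin n → Bool → H
  /-- the value embeddings -/
  value : Fin n → Bool → (Fin d → ℝ)

attribute [instance] SelfAttentionHead.instNormed SelfAttentionHead.instInner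

/-- The last bit `x_n` of an input of positive length. -/
def lastBit {n : ℕ} [NeZero n] (x : Fin n → Bool) : Bool :=
  x ⟨n - 1, Nat.sub_one_lt (NeZero.ne n)⟩

namespace SelfAttentionHead

variable {n d : ℕ} [NeZero n]

/-- The unnormalized attention weight `exp ⟨query x_n, key_i x_i⟩` of position `i`. -/
noncomputable def weight (A : SelfAttentionHead.{u} n d) (x : Fin n → Bool) (i : Fin n) : ℝ :=
  Real.exp (inner ℝ (A.query (lastBit x)) (A.key i (x i)))

/-- The function `{0,1}^n → ℝ^d` computed by the head: the softmax average of the values. -/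
noncomputable def eval (A : SelfAttentionHead.{u} n d) (x : Fin n → Bool) : Fin d → ℝ :=
  (∑ i, A.weight x i)⁻¹ • ∑ i, A.weight x i • A.value i (x i)

end SelfAttentionHead

/-- The sum `A_1(x) + ⋯ + A_h(x)` of the outputs of `h` self-attention heads. -/
noncomputable def headSum {n d h : ℕ} [NeZero n] (A : Fin h → SelfAttentionHead.{u} n d)
    (x : Fin n → Bool) : Fin d → ℝ :=
  ∑ j, (A j).eval x

/-- The self-attention layer with heads `A_1, …, A_h` post-processed by `f`. -/
noncomputable def selfAttentionLayer {n d h : ℕ} [NeZero n]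
    (A : Fin h → SelfAttentionHead.{u} n d) (f : (Fin d → ℝ) → ℝ) (x : Fin n → Bool) : ℝ :=
  f (headSum A x)

/-- The parity function: `true` exactly when an odd number of the bits are `true`. -/
def parity {n : ℕ} (x : Fin n → Bool) : Bool :=
  decide (Odd (Finset.univ.filter (fun i => x i = true)).card)

/-- `f` `(τ, γ)`-represents the Boolean function `g`. -/
def Represents {n : ℕ} (τ γ : ℝ) (f : (Fin n → Bool) → ℝ) (g : (Fin n → Bool) → Bool) : Prop :=
  ∀ x, (g x = true → τ + γ ≤ f x) ∧ (g x = false → f x ≤ τ - γ)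

/-- Scalar-output layered feed-forward ReLU networks, indexed by the input dimension.
`layer W b N` feeds the input through one layer of `w` ReLU gates, gate `i` having weight vector
`W i` and bias `b i`, and passes the gate values on to `N`. `output a b` is the
affine read-out `z ↦ a ⬝ᵥ z + b`; reading off a single gate of the last layer (a final ReLU gate
as the output node) is the special case of a coordinate vector `a` and `b = 0`. -/
inductive ReLUNetwork : ℕ → Type
  | output {k : ℕ} (a : Fin k → ℝ) (b : ℝ) : ReLUNetwork k
  | layer {k w : ℕ} (W : Fin w → Fin k → ℝ) (b : Fin w → ℝ) (N : ReLUNetwork w) : ReLUNetwork k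

namespace ReLUNetwork

/-- The function computed by the network, with `relu t = max 0 t`. -/
def eval : {k : ℕ} → ReLUNetwork k → (Fin k → ℝ) → ℝ
  | _, output a b, z => a ⬝ᵥ z + b
  | _, layer W b N, z => N.eval (fun i => max 0 (W i ⬝ᵥ z + b i))

/-- The number of layers of ReLU gates. -/
def depth : {k : ℕ} → ReLUNetwork k → ℕ
  | _, output _ _ => 0
  | _, layer _ _ N => N.depth + 1

/-- Every layer has at most `m` ReLU gates. -/
def WidthLE (m : ℕ) : {k : ℕ} → ReLUNetwork k → Prop
  | _, output _ _ => True
  | _, layer (w := w) _ _ N => w ≤ m ∧ N.WidthLE m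

/-- Every gate, and the read-out, has weights `a` and bias `b` with `‖a‖₁ + |b| ≤ 1`. -/
def Normalized : {k : ℕ} → ReLUNetwork k → Prop
  | _, output a b => ∑ j, |a j| + |b| ≤ 1
  | _, layer W b N => (∀ i, ∑ j, |W i j| + |b i| ≤ 1) ∧ N.Normalized

end ReLUNetwork

/-- The cube `[-1,1]^d`. -/
def cube (d : ℕ) : Set (Fin d → ℝ) := {y | ∀ k, y k ∈ Set.Icc (-1 : ℝ) 1}

/-- On the cube `[-1,1]^d`, the function `f` is computed by a normalized ReLU network with at most
`m` gates in each of at most `ℓ` (and at least one) layers. -/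
def ComputedByReLU {d : ℕ} (m ℓ : ℕ) (f : (Fin d → ℝ) → ℝ) : Prop :=
  ∃ N : ReLUNetwork d, N.Normalized ∧ N.WidthLE m ∧ 1 ≤ N.depth ∧ N.depth ≤ ℓ ∧
    ∀ y ∈ cube d, f y = N.eval y

/-! Parity is hard for rational functions of low degree. Once the last bit is frozen, the query is
constant, so a head is a quotient of sums of one-bit functions, and a linear functional of `h` heads
has rational degree at most `h`. Newman's idea gives a rational function of degree `2 * M ^ 2 + 1`
within `2⁻ᴹ` of ReLU on `[-1, 1]`. Replacing each gate by it multiplies the degree by at most `m *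
(2 * M ^ 2 + 1)` per layer, while the normalization lets the errors only add up
(`ReLUNetwork.exists_rational_approx`). If the total error `ℓ * 2⁻ᴹ` is below the margin, clearing
the denominator leaves a low-degree function with the sign pattern of parity. Parity is orthogonal
to everything of degree below the number of free bits (`sum_mul_eq_zero_of_mem_lowDegree`), so the
degree is at least `n - 1`. Taking `M` of order `(ln n)²` covers every polynomial margin. -/

/-- The span of the functions on the cube that depend on at most `D` coordinates. -/
def lowDegree {ι : Type*} (D : ℕ) : Submodule ℝ ((ι → Bool) → ℝ) :=
  Submodule.span ℝ {f | ∃ S : Finset ι, S.card ≤ D ∧ ∀ x y, (∀ i ∈ S, x i = y i) → f x = f y}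

/-! ### Degree and rational degree on the cube -/

section LowDegree

variable {ι : Type*}

theorem lowDegree_mono {D E : ℕ} (h : D ≤ E) :
    (lowDegree D : Submodule ℝ ((ι → Bool) → ℝ)) ≤ lowDegree E := by
  apply Submodule.span_mono
  rintro f ⟨S, hS, hf⟩
  exact ⟨S, hS.trans h, hf⟩

theorem const_mem_lowDegree (D : ℕ) (c : ℝ) :
    (fun _ => c : (ι → Bool) → ℝ) ∈ lowDegree D :=
  Submodule.subset_span ⟨∅, by simp, fun _ _ _ => rfl⟩

theorem coordinate_mem_lowDegree (i : ι) (g : Bool → ℝ) :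
    (fun x : ι → Bool => g (x i)) ∈ lowDegree 1 :=
  Submodule.subset_span ⟨{i}, by simp, fun x y h => by
    have : x i = y i := h i (by simp)
    simp only [this]⟩

theorem mul_mem_lowDegree {D E : ℕ} {f g : (ι → Bool) → ℝ} (hf : f ∈ lowDegree D)
    (hg : g ∈ lowDegree E) : f * g ∈ lowDegree (D + E) := by
  classical
  have h := Submodule.mul_mem_mul hf hg
  rw [lowDegree, lowDegree, Submodule.span_mul_span] at h
  refine Submodule.span_mono ?_ h
  rintro _ ⟨f, ⟨S, hS, hf⟩, g, ⟨T, hT, hg⟩, rfl⟩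
  refine ⟨S ∪ T, (Finset.card_union_le S T).trans (add_le_add hS hT), fun x y hxy => ?_⟩
  simp only [Pi.mul_apply]
  rw [hf x y fun i hi => hxy i (Finset.mem_union_left T hi),
    hg x y fun i hi => hxy i (Finset.mem_union_right S hi)]

theorem pow_mem_lowDegree {D : ℕ} {f : (ι → Bool) → ℝ} (hf : f ∈ lowDegree D) (k : ℕ) :
    f ^ k ∈ lowDegree (k * D) := by
  induction k with
  | zero =>
    rw [zero_mul]
    exact const_mem_lowDegree 0 1
  | succ k ih =>
    rw [pow_succ, add_mul, one_mul]
    exact mul_mem_lowDegree ih hf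

theorem prod_mem_lowDegree {κ : Type*} {D : ℕ} {f : κ → (ι → Bool) → ℝ} (s : Finset κ)
    (hf : ∀ k ∈ s, f k ∈ lowDegree D) : ∏ k ∈ s, f k ∈ lowDegree (s.card * D) := by
  classical
  induction s using Finset.induction_on with
  | empty =>
    rw [Finset.card_empty, zero_mul]
    exact const_mem_lowDegree 0 1
  | insert a s ha ih =>
    rw [Finset.prod_insert ha, Finset.card_insert_of_notMem ha, add_mul, one_mul, add_comm]
    exact mul_mem_lowDegree (hf a (by simp)) (ih fun k hk => hf k (by simp [hk]))

/-- A function that changes sign under every coordinate flip is orthogonal to all functions of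
degree less than the number of coordinates. -/
theorem sum_mul_eq_zero_of_mem_lowDegree [Fintype ι] [DecidableEq ι] {D : ℕ}
    (hD : D < Fintype.card ι) {s : (ι → Bool) → ℝ}
    (hs : ∀ x i, s (Function.update x i (!x i)) = -s x) {f : (ι → Bool) → ℝ}
    (hf : f ∈ lowDegree D) : ∑ x, s x * f x = 0 := by
  induction hf using Submodule.span_induction with
  | mem f hf =>
    obtain ⟨S, hS, hf⟩ := hf
    obtain ⟨i, hi⟩ : ∃ i, i ∉ S := by
      by_contra! h
      have : S = Finset.univ := Finset.eq_univ_of_forall h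
      rw [this, Finset.card_univ] at hS
      omega
    -- Flipping a coordinate outside `S` permutes the cube and negates every summand, so the sum
    -- equals its own negative.
    have hinv : Function.Involutive fun x : ι → Bool => Function.update x i (!x i) := by
      intro x
      simp
    have h := Equiv.sum_comp (Function.Involutive.toPerm _ hinv) fun x => s x * f x
    simp only [Function.Involutive.coe_toPerm] at h
    have h' : ∀ x, s (Function.update x i (!x i)) * f (Function.update x i (!x i)) =
        -(s x * f x) := by
      intro x
      have : f (Function.update x i (!x i)) = f x := by
        apply hf
        intro j hj
        rw [Function.update_of_ne]
        rintro rfl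
        exact hi hj
      rw [hs, this, neg_mul]
    simp only [h', Finset.sum_neg_distrib] at h
    linarith
  | zero => simp
  | add f g _ _ hf hg => simp [mul_add, Finset.sum_add_distrib, hf, hg]
  | smul c f _ hf =>
    have : ∑ x, s x * (c • f) x = c * ∑ x, s x * f x := by
      rw [Finset.mul_sum]
      exact Finset.sum_congr rfl fun x _ => by simp; ring
    rw [this, hf, mul_zero]

/-- `f` is a quotient of functions of degree at most `D` with positive denominator. -/
def HasRationalDegreeLE (D : ℕ) (f : (ι → Bool) → ℝ) : Prop :=
  ∃ Q ∈ lowDegree D, (∀ x, 0 < Q x) ∧ f * Q ∈ lowDegree D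

namespace HasRationalDegreeLE

theorem mono {D E : ℕ} {f : (ι → Bool) → ℝ} (hf : HasRationalDegreeLE D f) (h : D ≤ E) :
    HasRationalDegreeLE E f := by
  obtain ⟨Q, hQ, hpos, hfQ⟩ := hf
  exact ⟨Q, lowDegree_mono h hQ, hpos, lowDegree_mono h hfQ⟩

theorem const (c : ℝ) : HasRationalDegreeLE 0 (fun _ => c : (ι → Bool) → ℝ) :=
  ⟨1, const_mem_lowDegree 0 1, fun _ => one_pos, by
    rw [mul_one]
    exact const_mem_lowDegree 0 c⟩

/-- The denominators may differ and are multiplied, so degrees add. This is how the number of heads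
and the width become factors of the degree. -/
theorem add {D E : ℕ} {f g : (ι → Bool) → ℝ} (hf : HasRationalDegreeLE D f)
    (hg : HasRationalDegreeLE E g) : HasRationalDegreeLE (D + E) (f + g) := by
  obtain ⟨Q, hQ, hQpos, hfQ⟩ := hf
  obtain ⟨R, hR, hRpos, hgR⟩ := hg
  refine ⟨Q * R, mul_mem_lowDegree hQ hR, fun x => mul_pos (hQpos x) (hRpos x), ?_⟩
  have : (f + g) * (Q * R) = f * Q * R + Q * (g * R) := by ring
  rw [this]
  exact add_mem (mul_mem_lowDegree hfQ hR) (mul_mem_lowDegree hQ hgR)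

theorem smul {D : ℕ} {f : (ι → Bool) → ℝ} (hf : HasRationalDegreeLE D f) (c : ℝ) :
    HasRationalDegreeLE D (c • f) := by
  obtain ⟨Q, hQ, hpos, hfQ⟩ := hf
  exact ⟨Q, hQ, hpos, by rw [smul_mul_assoc]; exact Submodule.smul_mem _ c hfQ⟩

theorem sum {κ : Type*} {D : ℕ} {f : κ → (ι → Bool) → ℝ} (s : Finset κ)
    (hf : ∀ k ∈ s, HasRationalDegreeLE D (f k)) :
    HasRationalDegreeLE (s.card * D) (∑ k ∈ s, f k) := by
  classical
  induction s using Finset.induction_on with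
  | empty =>
    rw [Finset.card_empty, zero_mul]
    exact const 0
  | insert a s ha ih =>
    rw [Finset.sum_insert ha, Finset.card_insert_of_notMem ha, add_mul, one_mul, add_comm]
    exact add (hf a (by simp)) (ih fun k hk => hf k (by simp [hk]))

end HasRationalDegreeLE

end LowDegree

/-! ### Newman-type rational approximation of ReLU -/

section Newman

/-- The polynomial with simple roots at `-1, -1/2, …, -2⁻ᴹ⁺¹`. -/
noncomputable def dyadicPoly (M : ℕ) (t : ℝ) : ℝ := ∏ k ∈ Finset.range M, (t + (1 / 2) ^ k)

/-- A rational function of degree `2 M ^ 2 + 1` that approximates the ReLU function. -/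
noncomputable def ratReLU (M : ℕ) (t : ℝ) : ℝ :=
  t * (dyadicPoly M t ^ (2 * M) / (dyadicPoly M t ^ (2 * M) + dyadicPoly M (-t) ^ (2 * M)))

theorem dyadicPoly_pos (M : ℕ) {t : ℝ} (ht : 0 ≤ t) : 0 < dyadicPoly M t :=
  Finset.prod_pos fun _ _ => by positivity

theorem abs_dyadicPoly_neg_le (M : ℕ) {t : ℝ} (ht : 0 ≤ t) :
    |dyadicPoly M (-t)| ≤ dyadicPoly M t := by
  rw [dyadicPoly, dyadicPoly, Finset.abs_prod]
  refine Finset.prod_le_prod (fun _ _ => abs_nonneg _) fun k _ => ?_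
  have : (0 : ℝ) < (1 / 2) ^ k := by positivity
  rw [abs_le]
  constructor <;> linarith

/-- Some dyadic `a = 2⁻ᵏ` with `k < M` satisfies `a / 2 < t ≤ a`; its factor alone gives the ratio
`(a - t) / (a + t) ≤ 1 / 3`, and all other factors have ratio at most one. -/
theorem abs_dyadicPoly_neg_le_third (M : ℕ) {t : ℝ} (ht : (1 / 2) ^ M < t) (ht1 : t ≤ 1) :
    |dyadicPoly M (-t)| ≤ 1 / 3 * dyadicPoly M t := by
  have ht0 : 0 < t := lt_trans (by positivity) ht
  induction M with
  | zero =>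
    rw [pow_zero] at ht
    linarith
  | succ M ih =>
    have hpos : (0 : ℝ) < (1 / 2) ^ M := by positivity
    have hq := dyadicPoly_pos M ht0.le
    have hstep : ∀ s, dyadicPoly (M + 1) s = dyadicPoly M s * (s + (1 / 2) ^ M) :=
      fun s => Finset.prod_range_succ _ _
    rw [hstep, hstep, abs_mul, ← mul_assoc]
    rcases lt_or_ge ((1 / 2) ^ M) t with h | h
    · refine mul_le_mul (ih h) ?_ (abs_nonneg _) (by positivity)
      rw [abs_le]
      constructor <;> linarith
    · rw [pow_succ] at ht
      have : |-t + (1 / 2) ^ M| ≤ 1 / 3 * (t + (1 / 2) ^ M) := by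
        rw [abs_le]
        constructor <;> linarith
      calc _ ≤ dyadicPoly M t * (1 / 3 * (t + (1 / 2) ^ M)) :=
            mul_le_mul (abs_dyadicPoly_neg_le M ht0.le) this (abs_nonneg _) hq.le
        _ = _ := by ring

theorem dyadicPoly_pow_add_pos (M : ℕ) (t : ℝ) :
    0 < dyadicPoly M t ^ (2 * M) + dyadicPoly M (-t) ^ (2 * M) := by
  have h1 : 0 ≤ dyadicPoly M t ^ (2 * M) := (even_two_mul M).pow_nonneg _
  have h2 : 0 ≤ dyadicPoly M (-t) ^ (2 * M) := (even_two_mul M).pow_nonneg _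
  rcases le_total 0 t with h | h
  · have := pow_pos (dyadicPoly_pos M h) (2 * M)
    linarith
  · have := pow_pos (dyadicPoly_pos M (neg_nonneg.2 h)) (2 * M)
    linarith

/-- This keeps the surrogate gate values in `[-1, 1]`, so that the approximation bound applies again
in the next layer. -/
theorem abs_ratReLU_le (M : ℕ) (t : ℝ) : |ratReLU M t| ≤ |t| := by
  rw [ratReLU, abs_mul]
  refine mul_le_of_le_one_right (abs_nonneg t) ?_
  have h1 : 0 ≤ dyadicPoly M t ^ (2 * M) := (even_two_mul M).pow_nonneg _
  have h2 : 0 ≤ dyadicPoly M (-t) ^ (2 * M) := (even_two_mul M).pow_nonneg _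
  have h := dyadicPoly_pow_add_pos M t
  rw [abs_of_nonneg (div_nonneg h1 h.le), div_le_one h]
  linarith

/-- The common error term of `ratReLU` at `t` and `-t`. -/
theorem ratReLU_error_le (M : ℕ) {t : ℝ} (ht : 0 ≤ t) (ht1 : t ≤ 1) :
    t * (dyadicPoly M (-t) ^ (2 * M) / (dyadicPoly M t ^ (2 * M) + dyadicPoly M (-t) ^ (2 * M)))
      ≤ (1 / 2) ^ M := by
  have h1 : 0 < dyadicPoly M t ^ (2 * M) := pow_pos (dyadicPoly_pos M ht) _
  have h2 : 0 ≤ dyadicPoly M (-t) ^ (2 * M) := (even_two_mul M).pow_nonneg _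
  have h := dyadicPoly_pow_add_pos M t
  -- Near zero the prefactor `t` is itself small enough; elsewhere the power `2 * M` turns the ratio
  -- `1 / 3` into `9⁻ᴹ ≤ 2⁻ᴹ`.
  rcases le_or_gt t ((1 / 2) ^ M) with hle | hlt
  · refine (mul_le_of_le_one_right ht ?_).trans hle
    rw [div_le_one h]
    linarith
  · refine (mul_le_of_le_one_left (div_nonneg h2 h.le) ht1).trans ?_
    rw [div_le_iff₀ h]
    have h3 : dyadicPoly M (-t) ^ (2 * M) ≤ (1 / 2) ^ M * dyadicPoly M t ^ (2 * M) := by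
      calc dyadicPoly M (-t) ^ (2 * M) = |dyadicPoly M (-t)| ^ (2 * M) :=
            ((even_two_mul M).pow_abs _).symm
        _ ≤ (1 / 3 * dyadicPoly M t) ^ (2 * M) :=
            pow_le_pow_left₀ (abs_nonneg _) (abs_dyadicPoly_neg_le_third M hlt ht1) _
        _ = ((1 / 3) ^ 2) ^ M * dyadicPoly M t ^ (2 * M) := by rw [mul_pow, pow_mul (1 / 3 : ℝ)]
        _ ≤ _ := mul_le_mul_of_nonneg_right
            (pow_le_pow_left₀ (by norm_num) (by norm_num) M) h1.le
    have : 0 ≤ (1 / 2 : ℝ) ^ M * dyadicPoly M (-t) ^ (2 * M) := by positivity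
    linarith

theorem abs_ratReLU_sub_le (M : ℕ) {t : ℝ} (ht : |t| ≤ 1) :
    |ratReLU M t - max 0 t| ≤ (1 / 2) ^ M := by
  have h := dyadicPoly_pow_add_pos M t
  rcases le_total 0 t with h0 | h0
  · have hle := ratReLU_error_le M h0 (le_of_abs_le ht)
    have h2 : 0 ≤ dyadicPoly M (-t) ^ (2 * M) := (even_two_mul M).pow_nonneg _
    have : ratReLU M t - max 0 t = -(t * (dyadicPoly M (-t) ^ (2 * M) /
        (dyadicPoly M t ^ (2 * M) + dyadicPoly M (-t) ^ (2 * M)))) := by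
      rw [max_eq_right h0, ratReLU]
      field_simp
      ring
    rw [this, abs_neg, abs_of_nonneg (mul_nonneg h0 (div_nonneg h2 h.le))]
    exact hle
  · have hle := ratReLU_error_le M (neg_nonneg.2 h0) ((neg_le_abs t).trans ht)
    have h2 : 0 ≤ dyadicPoly M t ^ (2 * M) := (even_two_mul M).pow_nonneg _
    rw [neg_neg, add_comm (dyadicPoly M (-t) ^ (2 * M))] at hle
    rwa [max_eq_left h0, sub_zero, ratReLU, abs_mul, abs_of_nonpos h0,
      abs_of_nonneg (div_nonneg h2 h.le)]

variable {ι : Type*}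

/-- Homogenization: multiplying by `Q ^ (2 * M ^ 2)` gives each of the `2 * M ^ 2` linear factors
its own `Q`, making it `±f * Q + 2⁻ᵏ * Q`, of degree `D`. One more `Q` clears the prefactor `t`. -/
theorem HasRationalDegreeLE.ratReLU {D : ℕ} {f : (ι → Bool) → ℝ} (hf : HasRationalDegreeLE D f)
    (M : ℕ) : HasRationalDegreeLE ((2 * M ^ 2 + 1) * D) fun x => ratReLU M (f x) := by
  obtain ⟨Q, hQ, hpos, hfQ⟩ := hf
  have key : ∀ P : (ι → Bool) → ℝ, P * Q ∈ lowDegree D →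
      (fun x => dyadicPoly M (P x) ^ (2 * M) * Q x ^ (2 * M ^ 2)) ∈ lowDegree (2 * M ^ 2 * D) := by
    intro P hP
    have h : ∏ k ∈ Finset.range M, (P * Q + ((1 / 2 : ℝ) ^ k) • Q) ∈
        lowDegree ((Finset.range M).card * D) :=
      prod_mem_lowDegree _ fun k _ => add_mem hP (Submodule.smul_mem _ _ hQ)
    have h' := pow_mem_lowDegree h (2 * M)
    rw [Finset.card_range, ← mul_assoc, mul_assoc 2 M M, ← pow_two] at h'
    convert h' using 1
    ext x
    have : ∏ k ∈ Finset.range M, (P x * Q x + (1 / 2 : ℝ) ^ k * Q x) =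
        dyadicPoly M (P x) * Q x ^ M := by
      simp only [← add_mul, Finset.prod_mul_distrib, Finset.prod_const, Finset.card_range]
      rfl
    simp only [Pi.pow_apply, Finset.prod_apply, Pi.add_apply, Pi.mul_apply, Pi.smul_apply,
      smul_eq_mul, this, mul_pow]
    congr 1
    rw [← pow_mul]
    congr 1
    ring
  have h1 := key f hfQ
  have h2 := key (-f) (by rw [neg_mul]; exact neg_mem hfQ)
  have hdeg : 2 * M ^ 2 * D + D = (2 * M ^ 2 + 1) * D := by ring
  refine ⟨_, hdeg ▸ mul_mem_lowDegree (add_mem h1 h2) hQ, fun x => ?_, ?_⟩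
  · simp only [Pi.mul_apply, Pi.add_apply, Pi.neg_apply, ← add_mul]
    have := hpos x
    have := dyadicPoly_pow_add_pos M (f x)
    positivity
  · rw [← hdeg]
    convert mul_mem_lowDegree h1 hfQ using 1
    ext x
    simp only [Pi.mul_apply, Pi.add_apply, Pi.neg_apply]
    have := (dyadicPoly_pow_add_pos M (f x)).ne'
    rw [_root_.ratReLU]
    field_simp

end Newman

/-! ### Error and degree propagation through a network -/

section Network

theorem abs_dotProduct_le {k : ℕ} (a z : Fin k → ℝ) {δ : ℝ} (hz : ∀ i, |z i| ≤ δ) :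
    |a ⬝ᵥ z| ≤ (∑ j, |a j|) * δ := by
  rw [dotProduct, Finset.sum_mul]
  refine (Finset.abs_sum_le_sum_abs _ _).trans (Finset.sum_le_sum fun i _ => ?_)
  rw [abs_mul]
  exact mul_le_mul_of_nonneg_left (hz i) (abs_nonneg _)

theorem abs_affine_le_one {k : ℕ} {a : Fin k → ℝ} {b : ℝ} (hab : ∑ j, |a j| + |b| ≤ 1)
    {z : Fin k → ℝ} (hz : ∀ i, |z i| ≤ 1) : |a ⬝ᵥ z + b| ≤ 1 := by
  have := abs_dotProduct_le a z hz
  have := abs_add_le (a ⬝ᵥ z) b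
  linarith

/-- A normalized gate is 1-Lipschitz in the sup norm, so errors of earlier layers are not amplified.
-/
theorem abs_affine_sub_affine_le {k : ℕ} {a : Fin k → ℝ} {b : ℝ} (hab : ∑ j, |a j| + |b| ≤ 1)
    {z z' : Fin k → ℝ} {δ : ℝ} (hδ : 0 ≤ δ) (hz : ∀ i, |z i - z' i| ≤ δ) :
    |(a ⬝ᵥ z + b) - (a ⬝ᵥ z' + b)| ≤ δ := by
  have h := abs_dotProduct_le a (z - z') hz
  rw [add_sub_add_right_eq_sub, ← dotProduct_sub]
  refine h.trans (mul_le_of_le_one_left hδ ?_)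
  have := abs_nonneg b
  linarith

variable {ι : Type*}

/-- A normalized ReLU network of width `m` applied to functions whose affine combinations have
approximate rational degree at most `D` has small approximate rational degree. -/
theorem ReLUNetwork.exists_rational_approx (m M : ℕ) {k : ℕ} (N : ReLUNetwork k)
    (hN : N.Normalized) (hw : N.WidthLE m) {D : ℕ} {δ : ℝ} (hδ : 0 ≤ δ)
    {z z' : (ι → Bool) → Fin k → ℝ} (hz' : ∀ x i, |z' x i| ≤ 1)
    (hzz' : ∀ x i, |z x i - z' x i| ≤ δ)
    (hdeg : ∀ (a : Fin k → ℝ) (b : ℝ), HasRationalDegreeLE D fun x => a ⬝ᵥ z' x + b) :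
    ∃ g : (ι → Bool) → ℝ, HasRationalDegreeLE (D * (m * (2 * M ^ 2 + 1)) ^ N.depth) g ∧
      ∀ x, |N.eval (z x) - g x| ≤ δ + N.depth * (1 / 2) ^ M := by
  induction N generalizing D δ with
  | output a b =>
    refine ⟨_, by simpa [depth] using hdeg a b, fun x => ?_⟩
    simpa [depth, eval] using abs_affine_sub_affine_le hN hδ (hzz' x)
  | @layer k w W b N ih =>
    -- Here `z` carries the exact gate values and `z'` the rational surrogates. An affine
    -- combination of `w` surrogates, each of degree `(2 * M ^ 2 + 1) * D`, gives the new degree;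
    -- the new error is the inherited `δ` plus one approximation error.
    obtain ⟨g, hg, hgN⟩ := ih hN.2 hw.2 (D := w * ((2 * M ^ 2 + 1) * D))
      (δ := δ + (1 / 2) ^ M) (by positivity)
      (z := fun x i => max 0 (W i ⬝ᵥ z x + b i)) (z' := fun x i => ratReLU M (W i ⬝ᵥ z' x + b i))
      (fun x i => (abs_ratReLU_le M _).trans (abs_affine_le_one (hN.1 i) (hz' x)))
      (fun x i => by
        have h1 := abs_affine_sub_affine_le (hN.1 i) hδ (hzz' x)
        have h2 := abs_ratReLU_sub_le M (abs_affine_le_one (hN.1 i) (hz' x))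
        have h3 := abs_max_sub_max_le_abs (W i ⬝ᵥ z x + b i) (W i ⬝ᵥ z' x + b i) 0
        rw [max_comm _ 0, max_comm _ 0] at h3
        have h4 := abs_sub_le (max 0 (W i ⬝ᵥ z x + b i)) (max 0 (W i ⬝ᵥ z' x + b i))
          (ratReLU M (W i ⬝ᵥ z' x + b i))
        rw [abs_sub_comm (max 0 (W i ⬝ᵥ z' x + b i))] at h4
        linarith)
      (fun a c => by
        have h := (HasRationalDegreeLE.sum Finset.univ fun i _ =>
          ((hdeg (W i) (b i)).ratReLU M).smul (a i)).add (HasRationalDegreeLE.const c)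
        rw [Finset.card_univ, Fintype.card_fin, add_zero] at h
        convert h using 1
        ext x
        simp [dotProduct])
    refine ⟨g, hg.mono ?_, fun x => (hgN x).trans (le_of_eq ?_)⟩
    · calc w * ((2 * M ^ 2 + 1) * D) * (m * (2 * M ^ 2 + 1)) ^ N.depth
          ≤ m * ((2 * M ^ 2 + 1) * D) * (m * (2 * M ^ 2 + 1)) ^ N.depth := by
            gcongr
            exact hw.1
        _ = D * (m * (2 * M ^ 2 + 1)) ^ (N.depth + 1) := by ring
    · simp only [depth]
      push_cast
      ring

end Network

/-! ### Rational degree of attention heads -/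

section Heads

variable {n d : ℕ}

/-- Once the last bit is fixed, every linear functional of a head has rational degree one. -/
theorem SelfAttentionHead.hasRationalDegreeLE_eval (A : SelfAttentionHead.{u} (n + 1) d)
    (a : Fin d → ℝ) :
    HasRationalDegreeLE 1 fun y : Fin n → Bool => a ⬝ᵥ A.eval (Fin.snoc y false) := by
  have hlast : ∀ y : Fin n → Bool,
      lastBit (Fin.snoc y false : Fin (n + 1) → Bool) = false := fun y => by
    have : (⟨n + 1 - 1, Nat.sub_one_lt (NeZero.ne (n + 1))⟩ : Fin (n + 1)) = Fin.last n := rfl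
    rw [lastBit, this, Fin.snoc_last]
  have hcoord : ∀ (i : Fin (n + 1)) (g : Bool → ℝ), (fun y : Fin n → Bool =>
      g ((Fin.snoc y false : Fin (n + 1) → Bool) i)) ∈ lowDegree 1 := by
    intro i g
    refine Fin.lastCases ?_ (fun j => ?_) i
    · simpa using const_mem_lowDegree 1 (g false)
    · simpa using coordinate_mem_lowDegree j g
  have hpos : ∀ y : Fin n → Bool, 0 < ∑ i, A.weight (Fin.snoc y false) i := fun y =>
    Finset.sum_pos (fun i _ => Real.exp_pos _) Finset.univ_nonempty
  -- The softmax normalizer is the denominator; with the query frozen, each of its terms depends on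
  -- one bit, and so does each term of the numerator.
  refine ⟨fun y => ∑ i, A.weight (Fin.snoc y false) i, ?_, hpos, ?_⟩
  · have : (fun y : Fin n → Bool => ∑ i, A.weight (Fin.snoc y false) i) =
        ∑ i, fun y : Fin n → Bool => Real.exp (inner ℝ (A.query false)
          (A.key i ((Fin.snoc y false : Fin (n + 1) → Bool) i))) := by
      ext y
      simp only [weight, hlast, Finset.sum_apply]
    rw [this]
    exact sum_mem fun i _ => hcoord i fun t => Real.exp (inner ℝ (A.query false) (A.key i t))
  · have : (fun y : Fin n → Bool => a ⬝ᵥ A.eval (Fin.snoc y false)) *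
        (fun y => ∑ i, A.weight (Fin.snoc y false) i) =
        ∑ i, fun y : Fin n → Bool => Real.exp (inner ℝ (A.query false)
          (A.key i ((Fin.snoc y false : Fin (n + 1) → Bool) i))) *
          (a ⬝ᵥ A.value i ((Fin.snoc y false : Fin (n + 1) → Bool) i)) := by
      ext y
      have h := (hpos y).ne'
      simp only [Pi.mul_apply, eval, dotProduct_smul, dotProduct_sum, smul_eq_mul,
        Finset.sum_apply]
      rw [mul_comm, ← mul_assoc, mul_inv_cancel₀ h, one_mul]
      simp only [weight, hlast]
    rw [this]
    exact sum_mem fun i _ => hcoord i fun t =>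
      Real.exp (inner ℝ (A.query false) (A.key i t)) * (a ⬝ᵥ A.value i t)

theorem hasRationalDegreeLE_headSum {h : ℕ} (A : Fin h → SelfAttentionHead.{u} (n + 1) d)
    (a : Fin d → ℝ) (b : ℝ) :
    HasRationalDegreeLE h fun y : Fin n → Bool => a ⬝ᵥ headSum A (Fin.snoc y false) + b := by
  have h' := (HasRationalDegreeLE.sum Finset.univ fun j _ =>
    (A j).hasRationalDegreeLE_eval a).add (HasRationalDegreeLE.const b)
  rw [Finset.card_univ, Fintype.card_fin, add_zero, mul_one] at h'
  convert h' using 1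
  ext y
  simp [headSum, dotProduct_sum]

end Heads

/-! ### Parity against rational degree -/

section Parity

theorem parity_update {n : ℕ} (x : Fin n → Bool) (i : Fin n) :
    parity (Function.update x i (!x i)) = !parity x := by
  have hsplit : ∀ y : Fin n → Bool, (Finset.univ.filter fun j => y j = true).card =
      (if y i = true then 1 else 0) + ∑ j ∈ Finset.univ.erase i, if y j = true then 1 else 0 := by
    intro y
    rw [Finset.card_filter,
      Finset.add_sum_erase _ (fun j => if y j = true then 1 else 0) (Finset.mem_univ i)]
  have hrest : ∑ j ∈ Finset.univ.erase i,
      (if Function.update x i (!x i) j = true then 1 else 0) =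
      ∑ j ∈ Finset.univ.erase i, if x j = true then 1 else 0 :=
    Finset.sum_congr rfl fun j hj => by rw [Function.update_of_ne (Finset.ne_of_mem_erase hj)]
  rw [parity, parity, hsplit, hsplit x, hrest, Function.update_self]
  generalize (∑ j ∈ Finset.univ.erase i, if x j = true then 1 else 0) = s
  have h : (!decide (Even s)) = decide (Odd s) := by
    rw [← decide_not, decide_eq_decide, Nat.not_even_iff_odd]
  cases x i <;> simp [parity_simps, ← h]

/-- A function whose threshold at `τ` is the parity of `n + 1` bits, the last one fixed, has
rational degree at least `n`. -/
theorem le_of_hasRationalDegreeLE_of_parity {n D : ℕ} {g : (Fin n → Bool) → ℝ}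
    (hg : HasRationalDegreeLE D g) {τ : ℝ}
    (h1 : ∀ y, parity (Fin.snoc y false : Fin (n + 1) → Bool) = true → τ < g y)
    (h0 : ∀ y, parity (Fin.snoc y false : Fin (n + 1) → Bool) = false → g y < τ) : n ≤ D := by
  by_contra! hlt
  obtain ⟨Q, hQ, hpos, hgQ⟩ := hg
  -- The function `(g - τ) * Q` has degree at most `D < n` but agrees in sign with the parity
  -- character everywhere, so their inner product is both zero and positive.
  have hzero := sum_mul_eq_zero_of_mem_lowDegree (D := D) (by simpa using hlt)
    (s := fun y => if parity (Fin.snoc y false : Fin (n + 1) → Bool) = true then 1 else -1)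
    (fun y i => by
      have := parity_update (Fin.snoc y false : Fin (n + 1) → Bool) i.castSucc
      rw [Fin.snoc_castSucc, ← Fin.snoc_update] at this
      simp only [this]
      cases parity (Fin.snoc y false : Fin (n + 1) → Bool) <;> simp)
    (sub_mem hgQ (Submodule.smul_mem _ τ hQ))
  refine hzero.not_gt (Finset.sum_pos (fun y _ => ?_) Finset.univ_nonempty)
  simp only [Pi.sub_apply, Pi.mul_apply, Pi.smul_apply, smul_eq_mul, ← sub_mul]
  cases h : parity (Fin.snoc y false : Fin (n + 1) → Bool)
  · have := mul_pos (sub_pos.2 (h0 y h)) (hpos y)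
    simp only [Bool.false_eq_true, if_false]
    linarith
  · have := mul_pos (sub_pos.2 (h1 y h)) (hpos y)
    simpa using this

end Parity

/-! ### The degree bound and the choice of `M` -/

/-- The degree bound: a layer of `h` heads post-processed by a ReLU network represents parity with
margin larger than `ℓ 2⁻ᴹ` only if `h (m (2 M ^ 2 + 1)) ^ ℓ` is at least the number of bits
minus one. -/
theorem le_mul_pow_of_represents_parity {n d h m ℓ M : ℕ}
    (A : Fin h → SelfAttentionHead.{u} (n + 1) d) {f : (Fin d → ℝ) → ℝ} {τ γ : ℝ}
    (hA : ∀ x, headSum A x ∈ cube d) (hf : ComputedByReLU m ℓ f)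
    (hM : ℓ * (1 / 2 : ℝ) ^ M < γ) (hrep : Represents τ γ (selfAttentionLayer A f) parity) :
    n ≤ h * (m * (2 * M ^ 2 + 1)) ^ ℓ := by
  obtain ⟨N, hN, hw, hL, hLℓ, hfN⟩ := hf
  obtain ⟨g, hg, hgN⟩ := N.exists_rational_approx m M hN hw le_rfl
    (z := fun y : Fin n → Bool => headSum A (Fin.snoc y false))
    (z' := fun y : Fin n → Bool => headSum A (Fin.snoc y false))
    (fun y i => abs_le.2 (hA _ i)) (fun y i => by simp) (hasRationalDegreeLE_headSum A)
  have hclose : ∀ y : Fin n → Bool, |selfAttentionLayer A f (Fin.snoc y false) - g y| < γ := by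
    intro y
    rw [selfAttentionLayer, hfN _ (hA _)]
    have hcast : (N.depth : ℝ) ≤ ℓ := by exact_mod_cast hLℓ
    have : (N.depth : ℝ) * (1 / 2) ^ M ≤ ℓ * (1 / 2) ^ M := by gcongr
    have := hgN y
    linarith
  refine (le_of_hasRationalDegreeLE_of_parity hg (τ := τ) (fun y hy => ?_)
    fun y hy => ?_).trans (Nat.mul_le_mul_left h ?_)
  · have := (hrep _).1 hy
    have := abs_lt.1 (hclose y)
    linarith
  · have := (hrep _).2 hy
    have := abs_lt.1 (hclose y)
    linarith
  -- For `m = 0` the base vanishes, and the comparison relies on the depth being positive, since `0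
  -- ^ 0 = 1`.
  · rcases Nat.eq_zero_or_pos (m * (2 * M ^ 2 + 1)) with h0 | h0
    · rw [h0, zero_pow (by omega)]
      exact Nat.zero_le _
    · exact Nat.pow_le_pow_right h0 hLℓ

/-- With `s = ln n` the right side is `n ^ (-c)`. The bound `2⁻ᴹ ≤ exp (-s² / 2)` is quadratic in
`s` in the exponent and beats the linear losses from `ℓ < exp (ℓ * s)` and `c * s`. -/
theorem natCast_mul_half_pow_lt {ℓ M : ℕ} {c s : ℝ} (hs : 1 ≤ s) (hs' : 2 * (ℓ + |c|) < s)
    (hM : s ^ 2 ≤ M) : ℓ * (1 / 2 : ℝ) ^ M < Real.exp (-(c * s)) := by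
  have h1 : (1 / 2 : ℝ) ^ M ≤ Real.exp (-(s ^ 2 / 2)) := by
    have h2 : (1 / 2 : ℝ) ≤ Real.exp (-(1 / 2)) := by
      have := Real.add_one_le_exp (-(1 / 2) : ℝ)
      linarith
    calc (1 / 2 : ℝ) ^ M ≤ Real.exp (-(1 / 2)) ^ M := by gcongr
      _ = Real.exp (M * -(1 / 2)) := (Real.exp_nat_mul _ _).symm
      _ ≤ _ := Real.exp_le_exp.2 (by linarith)
  have h2 : (ℓ : ℝ) < Real.exp (ℓ * s) := by
    have := Real.add_one_le_exp (ℓ * s : ℝ)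
    have : (ℓ : ℝ) ≤ ℓ * s := le_mul_of_one_le_right (Nat.cast_nonneg ℓ) hs
    linarith
  calc ℓ * (1 / 2 : ℝ) ^ M ≤ ℓ * Real.exp (-(s ^ 2 / 2)) := by gcongr
    _ < Real.exp (ℓ * s) * Real.exp (-(s ^ 2 / 2)) :=
        mul_lt_mul_of_pos_right h2 (Real.exp_pos _)
    _ = Real.exp (ℓ * s - s ^ 2 / 2) := by rw [← Real.exp_add, sub_eq_add_neg]
    _ ≤ _ := Real.exp_le_exp.2 (by nlinarith [le_abs_self c])

theorem corollary1 :
    ∃ K : ℕ, ∀ (ℓ : ℕ) (c : ℝ), ∃ n₀ : ℕ, ∀ (n : ℕ) [NeZero n], n₀ ≤ n →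
      ∀ (h d m : ℕ) (A : Fin h → SelfAttentionHead.{u} n d) (f : (Fin d → ℝ) → ℝ) (τ γ : ℝ),
        (∀ x : Fin n → Bool, headSum A x ∈ cube d) →
        ComputedByReLU m ℓ f →
        0 < γ → γ ≤ 1 → (n : ℝ) ^ (-c) ≤ γ →
        Represents τ γ (selfAttentionLayer A f) parity →
        (n : ℝ) / Real.log n ^ (K * ℓ) ≤ (h : ℝ) * (m : ℝ) ^ ℓ := by
  -- For `M ≤ 2 * s ^ 2`, a layer costs `2 * (2 * M ^ 2 + 1) ≤ 18 * s ^ 4`, and `s ≥ 18` absorbs the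
  -- constant into a fifth power.
  refine ⟨5, fun ℓ c => ?_⟩
  have hev : ∀ᶠ n : ℕ in Filter.atTop, 18 + 2 * (ℓ + |c|) ≤ Real.log n ∧ 2 ≤ n :=
    ((Real.tendsto_log_atTop.comp tendsto_natCast_atTop_atTop).eventually_ge_atTop _).and
      (Filter.eventually_ge_atTop 2)
  obtain ⟨n₀, hn₀⟩ := Filter.eventually_atTop.1 hev
  refine ⟨n₀, fun n _ hn h d m A f τ γ hA hf _ _ hγ hrep => ?_⟩
  obtain ⟨hlog, hn2⟩ := hn₀ n hn
  have hℓ : 1 ≤ ℓ := by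
    obtain ⟨N, -, -, h1, h2, -⟩ := hf
    exact h1.trans h2
  obtain ⟨k, rfl⟩ : ∃ k, n = k + 1 := ⟨n - 1, by omega⟩
  set s := Real.log ((k + 1 : ℕ) : ℝ) with hs
  have hc := abs_nonneg c
  have hℓ0 : (0 : ℝ) ≤ ℓ := Nat.cast_nonneg ℓ
  have hs18 : 18 ≤ s := by linarith
  have hexp : ((k + 1 : ℕ) : ℝ) ^ (-c) = Real.exp (-(c * s)) := by
    rw [Real.rpow_def_of_pos (by positivity)]
    congr 1
    ring
  obtain ⟨M, hM, hM'⟩ : ∃ M : ℕ, s ^ 2 ≤ M ∧ (M : ℝ) ≤ 2 * s ^ 2 :=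
    ⟨⌈s ^ 2⌉₊, Nat.le_ceil _, (Nat.ceil_lt_add_one (sq_nonneg s)).le.trans (by nlinarith)⟩
  have hbound := le_mul_pow_of_represents_parity A hA hf
    (lt_of_lt_of_le (natCast_mul_half_pow_lt (by linarith) (by linarith) hM) (hexp ▸ hγ)) hrep
  have hboundR : (k : ℝ) ≤ h * (m * (2 * (M : ℝ) ^ 2 + 1)) ^ ℓ := by exact_mod_cast hbound
  have hM4 : 2 * (2 * (M : ℝ) ^ 2 + 1) ≤ s ^ 5 := by
    have h1 : (M : ℝ) ^ 2 ≤ (2 * s ^ 2) ^ 2 := by gcongr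
    have h2 : 18 * s ^ 4 ≤ s * s ^ 4 := by gcongr
    have h3 : 1 ≤ s ^ 4 := one_le_pow₀ (by linarith)
    nlinarith
  have hk : ((k + 1 : ℕ) : ℝ) ≤ 2 * k := by
    have : k + 1 ≤ 2 * k := by omega
    exact_mod_cast this
  rw [div_le_iff₀ (by positivity)]
  -- The factor 2 lost by freezing one bit is at most `2 ^ ℓ`, as `ℓ ≥ 1`, and is shared among the
  -- layers.
  calc ((k + 1 : ℕ) : ℝ) ≤ 2 * k := hk
    _ ≤ 2 ^ ℓ * (h * (m * (2 * (M : ℝ) ^ 2 + 1)) ^ ℓ) :=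
        mul_le_mul (le_self_pow₀ one_le_two (by omega)) hboundR (Nat.cast_nonneg k) (by positivity)
    _ = h * m ^ ℓ * (2 * (2 * (M : ℝ) ^ 2 + 1)) ^ ℓ := by simp only [mul_pow]; ring
    _ ≤ h * m ^ ℓ * (s ^ 5) ^ ℓ := by gcongr
    _ = h * m ^ ℓ * s ^ (5 * ℓ) := by rw [pow_mul]
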